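/- Let $T$ be a simplicial tree (with unit edge lengths, not necessarily locally finite), identified with its geometric realisation, let $v_0$ be a vertex of $T$, and let $d$ be the path metric. For $g\in\mathrm{Aut}(T)$ let $|g|=d(v_0,gv_0)$ and $l(g)=\min_{w\in T}d(w,gw)$, the minimum being over all points of the geometric realisation; $g$ is *hyperbolic* if $l(g)>0$ (so inversions of edges are not hyperbolic). A subgroup of $\mathrm{Aut}(T)$ is *purely hyperbolic* if all its nontrivial elements are hyperbolic. Let $P$ be the set of paths without backtracking in $T$ with initial vertex $v_0$, and $P_i\subseteq P$ the set of those of length $i$. Fix a strict well-ordering $<_i$ of $P_i$ for each $i\ge 0$ such that, whenever $j<i$, $p,q\in P_i$, and the initial subpaths $p',q'$ of length $j$ of $p,q$ satisfy $p'<_jq'$, then $p<_iq$. For $p,q\in P$ put $p<q$ if $|p|<|q|$, or $|p|=|q|$ and $p<_{|p|}q$. For unordered pairs $A,B$ of elements of $P$ (with repetition allowed) put $A\prec B$ if $A\ne B$ and the $<$-smallest path whose multiplicities in $A$ and in $B$ differ has the larger multiplicity in $A$; for pairs of distinct paths this says $\min_<\bigl((A\cup B)\setminus(A\cap B)\bigr)\in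 A$. Let $H(g)$ be the initial subpath of $[v_0,gv_0]$ of length $\lfloor |g|/2\rfloor$. For $g,h\in\mathrm{Aut}(T)$ put $g\prec h$ if $|g|=|h|$ and $\{H(g),H(g^{-1})\}\prec\{H(h),H(h^{-1})\}$ as unordered pairs, and put $g<^\star h$ if $|g|<|h|$ or $g\prec h$. For $X\subseteq\mathrm{Aut}(T)$ put $X^-=\{x^{-1}: x\in X\}$ and $X^\pm=X\cup X^-$. The set $X$ is *strongly N-reduced* (with respect to $v_0$ and $<^\star$) if it is a free basis of the group $\langle X\rangle$ it generates and - (N1) $X\cap X^-=\varnothing$; - (N4) for all $x,y\in X^\pm$ with $x\ne y^{-1}$, $x<^\star xy$. **Theorem.** Let $X$ and $Y$ be finite generating sets of the same purely hyperbolic subgroup of $\mathrm{Aut}(T)$. If $X$ and $Y$ are both strongly N-reduced with respect to $v_0$ and $<^\star$, then $X^\pm=Y^\pm$. -/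

import Mathlib

open scoped Pointwise

noncomputable section

namespace TreeAut

variable {V : Type*} (T : SimpleGraph V)

/-! Points of the geometric realisation of a simplicial tree `T`, and translation lengths. -/

/-- A description of a point of the geometric realisation of `T`: a vertex, or the point at
distance `t` from the initial vertex of an oriented edge `e` (edges have length one). The same
point may have several descriptions; these are at distance zero from each other. -/
inductive Point where
  | vertex (v : V) : Point
  | onEdge (e : T.Dart) (t : ℝ) (ht : t ∈ Set.Icc (0 : ℝ) 1) : Point

variable {T}

/-- The path metric on the geometric realisation of a tree. -/
def Point.dist : Point T → Point T → ℝ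
  | .vertex a, .vertex b => T.dist a b
  | .vertex a, .onEdge e t _ => min (T.dist a e.fst + t) (T.dist a e.snd + (1 - t))
  | .onEdge e t _, .vertex a => min (T.dist a e.fst + t) (T.dist a e.snd + (1 - t))
  | .onEdge d s _, .onEdge e t _ =>
      open Classical in
      if d = e then |s - t|
      else if d = e.symm then |s - (1 - t)|
      else min
        (min (s + T.dist d.fst e.fst + t) (s + T.dist d.fst e.snd + (1 - t)))
        (min ((1 - s) + T.dist d.snd e.fst + t) ((1 - s) + T.dist d.snd e.snd + (1 - t)))

/-- The action of an automorphism of `T` on the points of the geometric realisation. -/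
def Point.map (g : T ≃g T) : Point T → Point T
  | .vertex v => .vertex (g v)
  | .onEdge e t ht => .onEdge (g.toHom.mapDart e) t ht

/-- The translation length `l(g)`: the least distance by which `g` moves a point of the
geometric realisation. (In a tree the infimum is attained.) -/
def translationLength (g : T ≃g T) : ℝ := ⨅ w : Point T, Point.dist w (w.map g)

/-- `g` is hyperbolic if `l(g) > 0`; so inversions of edges are elliptic. -/
def IsHyperbolic (g : T ≃g T) : Prop := 0 < translationLength g

/-- A group of automorphisms is purely hyperbolic if its nontrivial elements are hyperbolic. -/
def PurelyHyperbolic (G : Subgroup (T ≃g T)) : Prop := ∀ g ∈ G, g ≠ 1 → IsHyperbolic g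

/-! Paths starting at the base vertex, and the lexicographic well-orderings of these. -/

variable (T) in
/-- The set of paths (without backtracking) in `T` with initial vertex `v₀`. -/
abbrev RootedPath (v₀ : V) := Σ w : V, T.Path v₀ w

/-- The number of edges of a path. -/
def RootedPath.length {v₀ : V} (p : RootedPath T v₀) : ℕ := (p.2 : T.Walk v₀ p.1).length

/-- The initial subpath with `n` edges (the whole path if it has fewer than `n` edges). -/
def RootedPath.take {v₀ : V} (p : RootedPath T v₀) (n : ℕ) : RootedPath T v₀ :=
  ⟨(p.2 : T.Walk v₀ p.1).getVert n, (p.2 : T.Walk v₀ p.1).take n, p.2.2.take n⟩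

theorem RootedPath.length_take {v₀ : V} (p : RootedPath T v₀) (n : ℕ) :
    (p.take n).length = min n p.length :=
  SimpleGraph.Walk.take_length _ _

variable (T) in
/-- The set of paths of length `i` with initial vertex `v₀`. -/
abbrev PathsOfLength (v₀ : V) (i : ℕ) := {p : RootedPath T v₀ // p.length = i}

/-- The initial subpath of length `j` of a path of length `i ≥ j`. -/
def PathsOfLength.take {v₀ : V} {i : ℕ} (p : PathsOfLength T v₀ i) (j : ℕ) (hj : j ≤ i) :
    PathsOfLength T v₀ j :=
  ⟨p.1.take j, by rw [RootedPath.length_take, p.2, min_eq_left hj]⟩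

variable (T) in
/-- A choice of well-orderings, one on the set of paths of length `i` from `v₀` for each `i`,
compatible with initial subpaths: if proper initial subpaths of the same length `j` of `p` and `q`
are already strictly ordered, then `p` and `q` are ordered the same way. -/
structure LexWellOrders (v₀ : V) where
  /-- The strict well-ordering on the paths of length `i`. -/
  lt : ∀ i : ℕ, PathsOfLength T v₀ i → PathsOfLength T v₀ i → Prop
  isWellOrder : ∀ i, IsWellOrder (PathsOfLength T v₀ i) (lt i)
  lex : ∀ (i j : ℕ) (hj : j < i) (p q : PathsOfLength T v₀ i),
    lt j (p.take j hj.le) (q.take j hj.le) → lt i p q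

namespace LexWellOrders

variable {v₀ : V} (o : LexWellOrders T v₀)

/-- The induced ordering on all paths from `v₀`: shorter paths first, paths of the same length
by the chosen well-ordering. -/
def PathLT (p q : RootedPath T v₀) : Prop :=
  p.length < q.length ∨ ∃ h : p.length = q.length, o.lt q.length ⟨p, h⟩ ⟨q, rfl⟩

/-- The ordering `A ≺ B` on unordered pairs of paths: the smallest path that does not occur
equally often in `A` and in `B` occurs more often in `A`. For pairs of distinct paths this says
that the minimum of `(A ∪ B) \ (A ∩ B)` lies in `A`. -/
def PairLT (A B : Multiset (RootedPath T v₀)) : Prop :=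
  open Classical in
  ∃ m, B.count m < A.count m ∧ ∀ p, o.PathLT p m → A.count p = B.count p

end LexWellOrders

/-! The length and the initial half of an automorphism, and the orderings of automorphisms. -/

/-- `|g| = d(v₀, g v₀)`. -/
def absLen (v₀ : V) (g : T ≃g T) : ℕ := T.dist v₀ (g v₀)

/-- The unique path `[v₀, w]` in the tree `T`. -/
def pathTo (hT : T.IsTree) (v₀ w : V) : RootedPath T v₀ :=
  ⟨w, (hT.existsUnique_path v₀ w).choose, (hT.existsUnique_path v₀ w).choose_spec.1⟩

/-- The initial half `H(g)`: the initial subpath of `[v₀, g v₀]` of length `⌊|g| / 2⌋`. -/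
def initialHalf (hT : T.IsTree) (v₀ : V) (g : T ≃g T) : RootedPath T v₀ :=
  (pathTo hT v₀ (g v₀)).take (absLen v₀ g / 2)

/-- The unordered pair of `H(g)` and `H(g⁻¹)`. -/
def halfPair (hT : T.IsTree) (v₀ : V) (g : T ≃g T) : Multiset (RootedPath T v₀) :=
  {initialHalf hT v₀ g, initialHalf hT v₀ g⁻¹}

/-- `g ≺ h`. -/
def Prec (hT : T.IsTree) {v₀ : V} (o : LexWellOrders T v₀) (g h : T ≃g T) : Prop :=
  absLen v₀ g = absLen v₀ h ∧ o.PairLT (halfPair hT v₀ g) (halfPair hT v₀ h)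

/-- The strict part `g <⋆ h` of the pre-well-ordering of automorphisms. -/
def StarLT (hT : T.IsTree) {v₀ : V} (o : LexWellOrders T v₀) (g h : T ≃g T) : Prop :=
  absLen v₀ g < absLen v₀ h ∨ Prec hT o g h

/-! Strongly N-reduced sets. -/

/-- `X^± = X ∪ X⁻¹`. -/
def plusMinus {A : Type*} [Group A] (X : Set A) : Set A := X ∪ X⁻¹

/-- `X` is a free basis of the subgroup `G`. -/
def IsFreeBasis {A : Type*} [Group A] (X : Set A) (G : Subgroup A) : Prop :=
  ∃ b : FreeGroupBasis X G, ∀ x : X, (b x : A) = x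

/-- `X` is strongly N-reduced with respect to `v₀` and the pre-well-ordering: it is a free basis
of the group that it generates and satisfies the conditions N1 and N4. -/
structure StronglyNReduced (hT : T.IsTree) {v₀ : V} (o : LexWellOrders T v₀)
    (X : Set (T ≃g T)) : Prop where
  isFreeBasis : IsFreeBasis X (Subgroup.closure X)
  n1 : X ∩ X⁻¹ = ∅
  n4 : ∀ x ∈ plusMinus X, ∀ y ∈ plusMinus X, x ≠ y⁻¹ → StarLT hT o x (x * y)

end TreeAut

end

namespace TreeAut

variable {V : Type*} {T : SimpleGraph V}

/-! ### Rooted paths and Gromov products in a tree -/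

/-! Up to inversion, a strongly N-reduced basis of `G` is recovered from `G` alone: its elements are
those `g` in `G` that are not products of `<⋆`-smaller elements of `G` (`plusMinus_eq`). Two such
bases therefore agree.

The key fact is that every factor of a reduced word with at least two letters is `<⋆`-smaller than
the word. N4 gives this for two letters. For longer words, a letter is never consumed by
cancellation at its two ends (`absLen_add_lt`): otherwise its two halves would each precede the
other. So appending a letter changes the length exactly as it would after the last letter alone
(`absLen_mul_add_eq_of_lt`). Ties in length are settled by `prec_mul_iff`, which reduces them to
comparing the two halves of one factor; hyperbolicity makes these halves distinct.

If a basis element were a product of smaller elements of `G`, expanding these as reduced words would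
express it by other basis letters, contradicting freeness. -/

theorem length_eq_dist_of_isPath (hT : T.IsTree) {a b : V} {p : T.Walk a b} (hp : p.IsPath) :
    p.length = T.dist a b := by
  obtain ⟨q, hq, hql⟩ := hT.connected.exists_path_of_dist a b
  rw [← hql, (hT.existsUnique_path a b).unique hp hq]

theorem RootedPath.length_eq_dist (hT : T.IsTree) {v₀ : V} (p : RootedPath T v₀) :
    p.length = T.dist v₀ p.1 :=
  length_eq_dist_of_isPath hT p.2.2

theorem RootedPath.ext_of_isTree (hT : T.IsTree) {v₀ : V} {p q : RootedPath T v₀}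
    (h : p.1 = q.1) : p = q := by
  obtain ⟨a, p⟩ := p
  obtain ⟨b, q⟩ := q
  obtain rfl : a = b := h
  rw [Subtype.ext ((hT.existsUnique_path v₀ a).unique p.2 q.2)]

theorem RootedPath.take_take (hT : T.IsTree) {v₀ : V} (p : RootedPath T v₀) (n m : ℕ) :
    (p.take n).take m = p.take (min n m) :=
  RootedPath.ext_of_isTree hT (SimpleGraph.Walk.take_getVert _ n m)

theorem pathTo_length (hT : T.IsTree) (v₀ a : V) : (pathTo hT v₀ a).length = T.dist v₀ a :=
  RootedPath.length_eq_dist hT _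

theorem pathTo_take_length (hT : T.IsTree) (v₀ a : V) {n : ℕ} (hn : n ≤ T.dist v₀ a) :
    ((pathTo hT v₀ a).take n).length = n := by
  rw [RootedPath.length_take, pathTo_length, min_eq_left hn]

theorem pathTo_take_of_le (hT : T.IsTree) (v₀ a : V) {n : ℕ} (hn : T.dist v₀ a ≤ n) :
    (pathTo hT v₀ a).take n = pathTo hT v₀ a := by
  refine RootedPath.ext_of_isTree hT ?_
  refine SimpleGraph.Walk.getVert_of_length_le _ ?_
  exact (pathTo_length hT v₀ a).le.trans hn

/-- If the paths from `v₀` to `a` and to `b` have a common initial subpath of length `n`, then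
they meet in an initial subpath of some length `m ≥ n` which realises the Gromov product. -/
theorem exists_dist_add_two_mul (hT : T.IsTree) (v₀ a b : V) :
    ∃ m, m ≤ T.dist v₀ a ∧ m ≤ T.dist v₀ b ∧ T.dist a b + 2 * m = T.dist v₀ a + T.dist v₀ b ∧
      ∀ n, n ≤ T.dist v₀ a → n ≤ T.dist v₀ b →
        ((pathTo hT v₀ a).take n = (pathTo hT v₀ b).take n ↔ n ≤ m) := by
  classical
  obtain ⟨p, hp, hpd⟩ : ∃ p : T.Walk v₀ a, p.IsPath ∧ p = (pathTo hT v₀ a).2.1 :=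
    ⟨_, (pathTo hT v₀ a).2.2, rfl⟩
  obtain ⟨q, hq, hqd⟩ : ∃ q : T.Walk v₀ b, q.IsPath ∧ q = (pathTo hT v₀ b).2.1 :=
    ⟨_, (pathTo hT v₀ b).2.2, rfl⟩
  have hpl := length_eq_dist_of_isPath hT hp
  have hql := length_eq_dist_of_isPath hT hq
  have key : ∀ n, (pathTo hT v₀ a).take n = (pathTo hT v₀ b).take n ↔
      p.getVert n = q.getVert n := by
    intro n
    subst hpd hqd
    exact ⟨fun h => congrArg Sigma.fst h, fun h => RootedPath.ext_of_isTree hT h⟩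
  have hd : ∀ (c : V) (r : T.Walk v₀ c), r.IsPath → ∀ n ≤ r.length,
      T.dist v₀ (r.getVert n) = n := by
    intro c r hr n hn
    rw [← length_eq_dist_of_isPath hT (hr.take n), SimpleGraph.Walk.take_length, min_eq_left hn]
  set N := min p.length q.length with hN
  set m := Nat.findGreatest (fun n => p.getVert n = q.getVert n) N with hm
  have hmN : m ≤ N := Nat.findGreatest_le _
  have hme : p.getVert m = q.getVert m :=
    Nat.findGreatest_spec (P := fun n => p.getVert n = q.getVert n) (Nat.zero_le N) (by simp)
  have hle : ∀ n ≤ N, p.getVert n = q.getVert n → n ≤ m := fun n hn h =>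
    Nat.le_findGreatest (P := fun n => p.getVert n = q.getVert n) hn h
  have hmp : m ≤ p.length := hmN.trans (min_le_left _ _)
  have hmq : m ≤ q.length := hmN.trans (min_le_right _ _)
  refine ⟨m, by omega, by omega, ?_, ?_⟩
  · have hr : ((p.drop m).reverse.append ((q.drop m).copy hme.symm rfl)).IsPath := by
      rw [SimpleGraph.Walk.isPath_def, SimpleGraph.Walk.support_append]
      have h2 : ((q.drop m).copy hme.symm rfl).IsPath := by
        simpa using hq.drop m
      refine List.Nodup.append ?_ ?_ ?_
      · exact ((hp.drop m).reverse).support_nodup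
      · exact h2.support_nodup.tail
      · intro w hw1 hw2
        have hw3 := List.mem_of_mem_tail hw2
        rw [SimpleGraph.Walk.support_reverse, List.mem_reverse,
          SimpleGraph.Walk.mem_support_iff_exists_getVert] at hw1
        rw [SimpleGraph.Walk.mem_support_iff_exists_getVert] at hw3
        obtain ⟨i, hi, hil⟩ := hw1
        obtain ⟨j, hj, hjl⟩ := hw3
        simp only [SimpleGraph.Walk.getVert_copy, SimpleGraph.Walk.drop_getVert,
          SimpleGraph.Walk.length_copy, SimpleGraph.Walk.drop_length] at hi hil hj hjl
        -- A vertex on both tails has the same distance from `v₀` along each, so `i = j`; maximality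
        -- of `m` then makes it the branch vertex, which occurs only once.
        have e1 := hd _ p hp (m + i) (by omega)
        have e2 := hd _ q hq (m + j) (by omega)
        rw [hi] at e1
        rw [hj] at e2
        have hij : i = j := by omega
        subst hij
        have := hle (m + i) (by omega) (hi.trans hj.symm)
        obtain rfl : i = 0 := by omega
        have hwm : w = p.getVert m := by rw [← hi]; simp
        have hnd := h2.support_nodup
        rw [← SimpleGraph.Walk.cons_tail_support] at hnd
        exact (List.nodup_cons.1 hnd).1 (hwm ▸ hw2)
    have := length_eq_dist_of_isPath hT hr
    rw [SimpleGraph.Walk.length_append, SimpleGraph.Walk.length_reverse,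
      SimpleGraph.Walk.length_copy, SimpleGraph.Walk.drop_length,
      SimpleGraph.Walk.drop_length] at this
    omega
  · intro n hna hnb
    rw [key]
    refine ⟨hle n (by omega), fun hn => ?_⟩
    have h := congrArg (fun r : RootedPath T v₀ => r.take n) ((key m).2 hme)
    simp only [RootedPath.take_take hT, min_eq_right hn] at h
    exact (key n).1 h

/-- The Gromov product is the length of the common initial path; comparisons of paths thus become
linear arithmetic. -/
theorem pathTo_take_eq_iff (hT : T.IsTree) (v₀ a b : V) {n : ℕ} (ha : n ≤ T.dist v₀ a)
    (hb : n ≤ T.dist v₀ b) :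
    (pathTo hT v₀ a).take n = (pathTo hT v₀ b).take n ↔
      2 * n + T.dist a b ≤ T.dist v₀ a + T.dist v₀ b := by
  obtain ⟨m, -, -, h3, h4⟩ := exists_dist_add_two_mul hT v₀ a b
  rw [h4 n ha hb]
  omega

/-! ### Automorphisms -/

theorem dist_map (g : T ≃g T) (hT : T.IsTree) (a b : V) : T.dist (g a) (g b) = T.dist a b := by
  have h : ∀ (g : T ≃g T) (a b : V), T.dist (g a) (g b) ≤ T.dist a b := by
    intro g a b
    obtain ⟨p, hp⟩ := hT.connected.exists_walk_length_eq_dist a b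
    rw [← hp, ← SimpleGraph.Walk.length_map g.toHom p]
    exact SimpleGraph.dist_le _
  refine le_antisymm (h g a b) ?_
  simpa using h g.symm (g a) (g b)

theorem dist_apply_apply (hT : T.IsTree) (v₀ : V) (g h : T ≃g T) :
    T.dist (g v₀) (h v₀) = absLen v₀ (g⁻¹ * h) := by
  rw [absLen, ← dist_map g hT v₀, ← RelIso.mul_apply, mul_inv_cancel_left]

theorem absLen_inv (hT : T.IsTree) (v₀ : V) (g : T ≃g T) : absLen v₀ g⁻¹ = absLen v₀ g := by
  have h := dist_apply_apply hT v₀ g 1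
  rw [mul_one] at h
  rw [← h, SimpleGraph.dist_comm]
  rfl

theorem absLen_one (v₀ : V) : absLen v₀ (1 : T ≃g T) = 0 :=
  SimpleGraph.dist_self

/-- The initial subpath of length `n` of `[v₀, g v₀]`. -/
noncomputable def initialPath (hT : T.IsTree) (v₀ : V) (g : T ≃g T) (n : ℕ) : RootedPath T v₀ :=
  (pathTo hT v₀ (g v₀)).take n

theorem initialPath_length (hT : T.IsTree) (v₀ : V) (g : T ≃g T) {n : ℕ}
    (hn : n ≤ absLen v₀ g) : (initialPath hT v₀ g n).length = n :=
  pathTo_take_length hT v₀ _ hn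

theorem initialPath_take (hT : T.IsTree) (v₀ : V) (g : T ≃g T) {n m : ℕ} (h : m ≤ n) :
    (initialPath hT v₀ g n).take m = initialPath hT v₀ g m := by
  rw [initialPath, RootedPath.take_take hT, min_eq_right h, initialPath]

theorem initialPath_eq_iff (hT : T.IsTree) (v₀ : V) (g h : T ≃g T) {n : ℕ}
    (hg : n ≤ absLen v₀ g) (hh : n ≤ absLen v₀ h) :
    initialPath hT v₀ g n = initialPath hT v₀ h n ↔
      2 * n + absLen v₀ (g⁻¹ * h) ≤ absLen v₀ g + absLen v₀ h := by
  rw [← dist_apply_apply hT]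
  exact pathTo_take_eq_iff hT v₀ _ _ hg hh

/-- The cancellation in the product `g * h`. -/
theorem exists_absLen_mul (hT : T.IsTree) (v₀ : V) (g h : T ≃g T) :
    ∃ c, c ≤ absLen v₀ g ∧ c ≤ absLen v₀ h ∧
      absLen v₀ (g * h) + 2 * c = absLen v₀ g + absLen v₀ h := by
  obtain ⟨m, h1, h2, h3, -⟩ := exists_dist_add_two_mul hT v₀ (g⁻¹ v₀) (h v₀)
  rw [dist_apply_apply hT, inv_inv] at h3
  have e := absLen_inv hT v₀ g
  unfold absLen at *
  exact ⟨m, by omega, h2, by omega⟩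

/-! ### Hyperbolic automorphisms -/

theorem Point.dist_nonneg (x y : Point T) : 0 ≤ Point.dist x y := by
  rcases x with a | ⟨d, s, hs⟩ <;> rcases y with b | ⟨e, t, ht⟩
  · exact Nat.cast_nonneg _
  · have := ht.1; have := ht.2
    simp only [Point.dist]
    refine le_min ?_ ?_
    · positivity
    · have : (0 : ℝ) ≤ 1 - t := by linarith
      positivity
  · have := hs.1; have := hs.2
    simp only [Point.dist]
    refine le_min ?_ ?_
    · positivity
    · have : (0 : ℝ) ≤ 1 - s := by linarith
      positivity
  · have := ht.1; have := hs.1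
    have h1 : (0 : ℝ) ≤ 1 - t := by linarith [ht.2]
    have h2 : (0 : ℝ) ≤ 1 - s := by linarith [hs.2]
    simp only [Point.dist]
    split_ifs
    · positivity
    · positivity
    · refine le_min (le_min ?_ ?_) (le_min ?_ ?_) <;> positivity

/-- A fixed vertex has displacement zero; nonnegativity of distances makes the infimum a genuine
lower bound. -/
theorem IsHyperbolic.apply_ne {g : T ≃g T} (hg : IsHyperbolic g) (v : V) : g v ≠ v := by
  intro h
  have hle : translationLength g ≤ Point.dist (.vertex v) ((Point.vertex v).map g) :=
    ciInf_le ⟨0, by rintro _ ⟨w, rfl⟩; exact Point.dist_nonneg _ _⟩ _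
  simp only [Point.map, Point.dist, h, SimpleGraph.dist_self, Nat.cast_zero] at hle
  exact absurd hg (not_lt.2 hle)

theorem IsHyperbolic.absLen_pos (hT : T.IsTree) {v₀ : V} {g : T ≃g T} (hg : IsHyperbolic g) :
    0 < absLen v₀ g :=
  hT.connected.pos_dist_of_ne (hg.apply_ne v₀).symm

/-- A hyperbolic automorphism does not fix the midpoint of `[v₀, g v₀]`. -/
theorem IsHyperbolic.initialPath_ne (hT : T.IsTree) {v₀ : V} {g : T ≃g T} (hg : IsHyperbolic g)
    {k : ℕ} (hk : absLen v₀ g = 2 * k) :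
    initialPath hT v₀ g k ≠ initialPath hT v₀ g⁻¹ k := by
  intro h
  set m : V := (initialPath hT v₀ g k).1 with hm
  have mid : ∀ f : T ≃g T, absLen v₀ f = 2 * k → T.dist v₀ (initialPath hT v₀ f k).1 = k ∧
      T.dist (initialPath hT v₀ f k).1 (f v₀) = k := by
    intro f hf
    have h1 : T.dist v₀ (initialPath hT v₀ f k).1 = k := by
      rw [← RootedPath.length_eq_dist hT, initialPath_length hT v₀ f (by omega)]
    refine ⟨h1, ?_⟩
    have h2 : (pathTo hT v₀ (initialPath hT v₀ f k).1).take k = initialPath hT v₀ f k := by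
      rw [pathTo_take_of_le hT _ _ h1.le]
      exact RootedPath.ext_of_isTree hT rfl
    have h3 := (pathTo_take_eq_iff hT v₀ _ (f v₀) h1.ge (by unfold absLen at hf; omega)).1 h2
    have h4 := hT.connected.dist_triangle (u := v₀) (v := (initialPath hT v₀ f k).1) (w := f v₀)
    unfold absLen at hf
    omega
  obtain ⟨a1, a2⟩ := mid g hk
  obtain ⟨-, a3⟩ := mid g⁻¹ (by rw [absLen_inv hT, hk])
  rw [← h, ← hm] at a3
  rw [← hm] at a1 a2
  -- `m` is also the midpoint of `[v₀, g⁻¹ v₀]`, so `g m` is the midpoint of `[v₀, g v₀]`, which is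
  -- `m`.
  have b1 : T.dist v₀ (g m) = k := by
    have e := dist_map g hT m (g⁻¹ v₀)
    rwa [RelIso.apply_inv_self, a3, SimpleGraph.dist_comm] at e
  have b2 : T.dist (g m) (g v₀) = k := by
    rw [dist_map g hT, SimpleGraph.dist_comm, a1]
  have h5 : pathTo hT v₀ (g m) = initialPath hT v₀ g k := by
    rw [← pathTo_take_of_le hT v₀ (g m) b1.le]
    refine (pathTo_take_eq_iff hT v₀ _ (g v₀) b1.ge (by unfold absLen at hk; omega)).2 ?_
    unfold absLen at hk
    omega
  exact hg.apply_ne m (congrArg Sigma.fst h5)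

end TreeAut

namespace TreeAut

variable {V : Type*} {T : SimpleGraph V}

/-! ### The orderings of paths and of pairs of paths -/

namespace LexWellOrders

variable {v₀ : V} (o : LexWellOrders T v₀)

theorem pathLT_iff {n : ℕ} (p q : PathsOfLength T v₀ n) : o.PathLT p.1 q.1 ↔ o.lt n p q := by
  obtain ⟨p, hp⟩ := p
  obtain ⟨q, rfl⟩ := q
  simp only [PathLT]
  exact ⟨fun h => h.elim (fun h => absurd hp h.ne) fun ⟨_, h⟩ => h, fun h => Or.inr ⟨hp, h⟩⟩

theorem pathLT_irrefl (p : RootedPath T v₀) : ¬ o.PathLT p p := by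
  have := o.isWellOrder p.length
  exact fun h => irrefl_of (o.lt p.length) _ ((o.pathLT_iff ⟨p, rfl⟩ ⟨p, rfl⟩).1 h)

theorem pathLT_trans {p q r : RootedPath T v₀} (h₁ : o.PathLT p q) (h₂ : o.PathLT q r) :
    o.PathLT p r := by
  rcases h₁ with h₁ | ⟨e₁, h₁⟩
  · rcases h₂ with h₂ | ⟨e₂, -⟩
    · exact Or.inl (h₁.trans h₂)
    · exact Or.inl (h₁.trans_eq e₂)
  · rcases h₂ with h₂ | ⟨e₂, h₂⟩
    · exact Or.inl (e₁.trans_lt h₂)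
    · have := o.isWellOrder r.length
      have h₃ : o.lt r.length ⟨p, e₁.trans e₂⟩ ⟨q, e₂⟩ :=
        (o.pathLT_iff ⟨p, e₁.trans e₂⟩ ⟨q, e₂⟩).1 (Or.inr ⟨e₁, h₁⟩)
      exact Or.inr ⟨e₁.trans e₂, trans_of (o.lt r.length) h₃ h₂⟩

theorem pathLT_trichotomous (p q : RootedPath T v₀) : o.PathLT p q ∨ p = q ∨ o.PathLT q p := by
  rcases lt_trichotomy p.length q.length with h | h | h
  · exact Or.inl (Or.inl h)
  · have := o.isWellOrder q.length
    rcases trichotomous_of (o.lt q.length) ⟨p, h⟩ ⟨q, rfl⟩ with h' | h' | h'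
    · exact Or.inl ((o.pathLT_iff ⟨p, h⟩ ⟨q, rfl⟩).2 h')
    · exact Or.inr (Or.inl (congrArg Subtype.val h'))
    · exact Or.inr (Or.inr ((o.pathLT_iff ⟨q, rfl⟩ ⟨p, h⟩).2 h'))
  · exact Or.inr (Or.inr (Or.inl h))

theorem pathLT_of_take {p q : RootedPath T v₀} {n k : ℕ} (hp : p.length = n) (hq : q.length = n)
    (hk : k < n) (h : o.PathLT (p.take k) (q.take k)) : o.PathLT p q := by
  refine (o.pathLT_iff ⟨p, hp⟩ ⟨q, hq⟩).2 (o.lex n k hk _ _ ?_)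
  exact (o.pathLT_iff (PathsOfLength.take ⟨p, hp⟩ k hk.le)
    (PathsOfLength.take ⟨q, hq⟩ k hk.le)).1 h

theorem pathLT_iff_of_take_ne {p q : RootedPath T v₀} {n k : ℕ} (hp : p.length = n)
    (hq : q.length = n) (hk : k < n) (hne : p.take k ≠ q.take k) :
    o.PathLT p q ↔ o.PathLT (p.take k) (q.take k) := by
  refine ⟨fun h => ?_, o.pathLT_of_take hp hq hk⟩
  rcases o.pathLT_trichotomous (p.take k) (q.take k) with h' | h' | h'
  · exact h'
  · exact absurd h' hne
  · exact absurd (o.pathLT_trans h (o.pathLT_of_take hq hp hk h')) (o.pathLT_irrefl p)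

theorem pairLT_irrefl (A : Multiset (RootedPath T v₀)) : ¬ o.PairLT A A :=
  fun ⟨_, h, _⟩ => lt_irrefl _ h

theorem pairLT_trans {A B C : Multiset (RootedPath T v₀)} (h₁ : o.PairLT A B)
    (h₂ : o.PairLT B C) : o.PairLT A C := by
  classical
  obtain ⟨m, hm, hm'⟩ := h₁
  obtain ⟨n, hn, hn'⟩ := h₂
  rcases o.pathLT_trichotomous m n with h | rfl | h
  · exact ⟨m, by rw [← hn' m h]; exact hm,
      fun p hp => (hm' p hp).trans (hn' p (o.pathLT_trans hp h))⟩
  · exact ⟨m, hn.trans hm, fun p hp => (hm' p hp).trans (hn' p hp)⟩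
  · exact ⟨n, by rw [hm' n h]; exact hn,
      fun p hp => (hm' p (o.pathLT_trans hp h)).trans (hn' p hp)⟩

/-- The common entry contributes equally to both counts, even when it coincides with `P` or `Q`. -/
theorem pairLT_pair_iff (A P Q : RootedPath T v₀) : o.PairLT {A, P} {A, Q} ↔ o.PathLT P Q := by
  classical
  have hc : ∀ R p : RootedPath T v₀, ({A, R} : Multiset (RootedPath T v₀)).count p =
      (if p = R then 1 else 0) + (if p = A then 1 else 0) := by
    intro R p
    rw [Multiset.insert_eq_cons, Multiset.count_cons, Multiset.count_singleton]
  constructor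
  · rintro ⟨m, hm, hm'⟩
    rw [hc, hc] at hm
    have hmP : m = P := by
      by_contra h
      simp [h] at hm
    subst hmP
    have hmQ : m ≠ Q := by
      rintro rfl
      simp at hm
    rcases o.pathLT_trichotomous m Q with h | h | h
    · exact h
    · exact absurd h hmQ
    · have := hm' Q h
      rw [hc, hc, if_neg hmQ.symm, if_pos rfl] at this
      omega
  · intro h
    have hne : P ≠ Q := fun e => o.pathLT_irrefl Q (e ▸ h)
    refine ⟨P, ?_, fun p hp => ?_⟩
    · rw [hc, hc, if_neg hne, if_pos rfl]
      omega
    · have h1 : p ≠ P := fun e => o.pathLT_irrefl P (e ▸ hp)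
      have h2 : p ≠ Q := by
        rintro rfl
        exact o.pathLT_irrefl _ (o.pathLT_trans hp h)
      rw [hc, hc, if_neg h1, if_neg h2]

end LexWellOrders

/-! ### The ordering of automorphisms -/

variable (hT : T.IsTree) {v₀ : V} (o : LexWellOrders T v₀)

theorem halfPair_inv (g : T ≃g T) : halfPair hT v₀ g⁻¹ = halfPair hT v₀ g := by
  rw [halfPair, inv_inv, Multiset.pair_comm, halfPair]

variable {hT}

theorem starLT_inv_left {g h : T ≃g T} : StarLT hT o g⁻¹ h ↔ StarLT hT o g h := by
  rw [StarLT, StarLT, Prec, Prec, halfPair_inv, absLen_inv hT]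

theorem starLT_inv_right {g h : T ≃g T} : StarLT hT o g h⁻¹ ↔ StarLT hT o g h := by
  rw [StarLT, StarLT, Prec, Prec, halfPair_inv, absLen_inv hT]

theorem starLT_irrefl (g : T ≃g T) : ¬ StarLT hT o g g := by
  rintro (h | ⟨-, h⟩)
  · exact lt_irrefl _ h
  · exact o.pairLT_irrefl _ h

variable {o}

theorem StarLT.trans {f g h : T ≃g T} (h₁ : StarLT hT o f g) (h₂ : StarLT hT o g h) :
    StarLT hT o f h := by
  rcases h₁ with h₁ | ⟨e₁, h₁⟩ <;> rcases h₂ with h₂ | ⟨e₂, h₂⟩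
  · exact Or.inl (h₁.trans h₂)
  · exact Or.inl (h₁.trans_eq e₂)
  · exact Or.inl (e₁.trans_lt h₂)
  · exact Or.inr ⟨e₁.trans e₂, o.pairLT_trans h₁ h₂⟩

theorem StarLT.absLen_le {g h : T ≃g T} (hgh : StarLT hT o g h) : absLen v₀ g ≤ absLen v₀ h :=
  hgh.elim le_of_lt fun h => h.1.le

theorem StarLT.prec {g h : T ≃g T} (hgh : StarLT hT o g h) (e : absLen v₀ h = absLen v₀ g) :
    Prec hT o g h :=
  hgh.elim (fun h => absurd e h.ne') id

variable (o)

/-- If the second half of a hyperbolic automorphism `x` survives and its first half is cancelled in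
the product `u * x`, then `u` and `u * x` are compared by comparing the two halves of `x`. -/
theorem prec_mul_iff {u x : T ≃g T} (hx : IsHyperbolic x)
    (h₁ : absLen v₀ (u * x) = absLen v₀ u) (h₂ : absLen v₀ x ≤ absLen v₀ u) :
    Prec hT o u (u * x) ↔ o.PathLT (initialHalf hT v₀ x) (initialHalf hT v₀ x⁻¹) := by
  obtain ⟨k, -, -, hk⟩ := exists_absLen_mul hT v₀ u x
  -- Equal lengths force the cancellation to be exactly half of `x`.
  replace hk : absLen v₀ x = 2 * k := by omega
  have hu := absLen_inv hT v₀ u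
  have hx' := absLen_inv hT v₀ x
  have hux := absLen_inv hT v₀ (u * x)
  set n := absLen v₀ u / 2 with hn
  have hkn : k ≤ n := by omega
  have e0 : initialHalf hT v₀ (u * x) = initialHalf hT v₀ u := by
    change initialPath hT v₀ (u * x) (absLen v₀ (u * x) / 2) = initialPath hT v₀ u n
    rw [h₁, ← hn, eq_comm, initialPath_eq_iff hT _ _ _ (by omega) (by omega),
      inv_mul_cancel_left]
    omega
  have e1 : initialHalf hT v₀ u⁻¹ = initialPath hT v₀ u⁻¹ n := by
    rw [hn, ← absLen_inv hT v₀ u]; rfl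
  have e2 : initialHalf hT v₀ (u * x)⁻¹ = initialPath hT v₀ (u * x)⁻¹ n := by
    rw [hn, ← h₁, ← absLen_inv hT v₀ (u * x)]; rfl
  have e3 : initialHalf hT v₀ x = initialPath hT v₀ x k := by
    change initialPath hT v₀ x (absLen v₀ x / 2) = _
    rw [hk, Nat.mul_div_cancel_left _ two_pos]
  have e4 : initialHalf hT v₀ x⁻¹ = initialPath hT v₀ x⁻¹ k := by
    change initialPath hT v₀ x⁻¹ (absLen v₀ x⁻¹ / 2) = _
    rw [hx', hk, Nat.mul_div_cancel_left _ two_pos]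
  -- The initial halves of `u` and `u * x` agree, so only those of the inverses matter. These begin
  -- with the two halves of `x`, which differ and so decide the lexicographic comparison.
  have e5 : (initialPath hT v₀ u⁻¹ n).take k = initialPath hT v₀ x k := by
    rw [initialPath_take hT _ _ hkn, initialPath_eq_iff hT _ _ _ (by omega) (by omega), inv_inv]
    omega
  have e6 : (initialPath hT v₀ (u * x)⁻¹ n).take k = initialPath hT v₀ x⁻¹ k := by
    rw [initialPath_take hT _ _ hkn, initialPath_eq_iff hT _ _ _ (by omega) (by omega), inv_inv,
      mul_inv_cancel_right]
    omega
  have hne := hx.initialPath_ne hT hk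
  rw [Prec, and_iff_right h₁.symm, halfPair, halfPair, e0, o.pairLT_pair_iff, e1, e2, e3, e4]
  rcases hkn.lt_or_eq with hlt | heq
  · rw [o.pathLT_iff_of_take_ne (initialPath_length hT v₀ _ (by omega))
      (initialPath_length hT v₀ _ (by omega)) hlt (by rwa [e5, e6]), e5, e6]
  · rw [initialPath_take hT _ _ hkn] at e5 e6
    rw [← heq, e5, e6]

end TreeAut

namespace TreeAut

/-! ### Reduced products -/

section Group

variable {A : Type*} [Group A]

/-- `IsReducedProd S u y`: the element `u` is a nonempty product of elements of `S`, without
adjacent inverse factors, whose last factor is `y`. -/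
inductive IsReducedProd (S : Set A) : A → A → Prop
  | single {y : A} (hy : y ∈ S) : IsReducedProd S y y
  | mul {u y x : A} (hu : IsReducedProd S u y) (hx : x ∈ S) (hyx : y ≠ x⁻¹) :
      IsReducedProd S (u * x) x

theorem IsReducedProd.last_mem {S : Set A} {u y : A} (h : IsReducedProd S u y) : y ∈ S := by
  cases h <;> assumption

theorem IsReducedProd.mem_closure {S : Set A} {u y : A} (h : IsReducedProd S u y) :
    u ∈ Subgroup.closure S := by
  induction h with
  | single hy => exact Subgroup.subset_closure hy
  | mul _ hx _ ih => exact mul_mem ih (Subgroup.subset_closure hx)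

theorem exists_isReducedProd {S : Set A} (hS : ∀ x ∈ S, x⁻¹ ∈ S) {g : A}
    (hg : g ∈ Subgroup.closure S) : g = 1 ∨ ∃ y, IsReducedProd S g y := by
  have step : ∀ g x : A, x ∈ S → (g = 1 ∨ ∃ y, IsReducedProd S g y) →
      (g * x = 1 ∨ ∃ y, IsReducedProd S (g * x) y) := by
    rintro g x hx (rfl | ⟨y, hy⟩)
    · exact Or.inr ⟨x, by simpa using IsReducedProd.single hx⟩
    · by_cases hyx : y = x⁻¹
      · subst hyx
        cases hy with
        | single => exact Or.inl (inv_mul_cancel x)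
        | mul hu _ _ => exact Or.inr ⟨_, by simpa using hu⟩
      · exact Or.inr ⟨x, hy.mul hx hyx⟩
  induction hg using Subgroup.closure_induction_right with
  | one => exact Or.inl rfl
  | mul_right g _ x hx ih => exact step g x hx ih
  | mul_inv_cancel g _ x hx ih => exact step g x⁻¹ (hS x hx) ih

theorem inv_mem_plusMinus {X : Set A} {x : A} (hx : x ∈ plusMinus X) : x⁻¹ ∈ plusMinus X :=
  hx.elim (fun h => Or.inr (by simpa using h)) Or.inl

theorem closure_plusMinus (X : Set A) : Subgroup.closure (plusMinus X) = Subgroup.closure X := by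
  rw [plusMinus, Subgroup.closure_union, Subgroup.closure_inv, sup_idem]

/-- An element of a free basis is not generated by the other elements and their inverses. -/
theorem IsFreeBasis.notMem_closure {X : Set A} (h : IsFreeBasis X (Subgroup.closure X)) {x : A}
    (hx : x ∈ plusMinus X) :
    x ∉ Subgroup.closure {z ∈ plusMinus X | z ≠ x ∧ z ≠ x⁻¹} := by
  classical
  have aux : ∀ x ∈ X, x ∉ Subgroup.closure {z ∈ plusMinus X | z ≠ x ∧ z ≠ x⁻¹} := by
    intro x hx hmem
    obtain ⟨b, hb⟩ := h
    -- The exponent sum in `x` kills all other basis elements but not `x`.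
    set f : Subgroup.closure X →* Multiplicative ℤ :=
      b.lift fun z => if z = ⟨x, hx⟩ then Multiplicative.ofAdd 1 else 1 with hf
    have hfb : ∀ z : X, f (b z) = if z = ⟨x, hx⟩ then Multiplicative.ofAdd 1 else 1 := fun z =>
      congrFun (b.lift.symm_apply_apply _) z
    have hXe : ∀ z (hz : z ∈ X), b ⟨z, hz⟩ = ⟨z, Subgroup.subset_closure hz⟩ := fun z hz =>
      Subtype.ext (hb ⟨z, hz⟩)
    have hker : ∀ z (hz : z ∈ Subgroup.closure {z ∈ plusMinus X | z ≠ x ∧ z ≠ x⁻¹})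
        (hz' : z ∈ Subgroup.closure X), f ⟨z, hz'⟩ = 1 := by
      have hle : Subgroup.closure {z ∈ plusMinus X | z ≠ x ∧ z ≠ x⁻¹} ≤
          f.ker.map (Subgroup.closure X).subtype := by
        rw [Subgroup.closure_le]
        have hX : ∀ z ∈ X, z ≠ x → z ∈ f.ker.map (Subgroup.closure X).subtype := by
          intro z hz hzx
          refine ⟨b ⟨z, hz⟩, ?_, hb _⟩
          rw [SetLike.mem_coe, MonoidHom.mem_ker, hfb, if_neg]
          exact fun e => hzx (congrArg Subtype.val e)
        rintro z ⟨hz | hz, hzx, hzx'⟩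
        · exact hX z hz hzx
        · have := inv_mem (hX z⁻¹ hz fun e => hzx' (by rw [← e, inv_inv]))
          rwa [inv_inv] at this
      intro z hz hz'
      obtain ⟨w, hw, rfl⟩ := hle hz
      exact hw
    have h1 := hker x hmem (Subgroup.subset_closure hx)
    rw [← hXe x hx, hfb, if_pos rfl] at h1
    exact one_ne_zero (Multiplicative.ofAdd.injective h1)
  rcases hx with hx | hx
  · exact aux x hx
  · intro hmem
    refine aux x⁻¹ hx (inv_mem ?_)
    simpa only [inv_inv, and_comm] using hmem

end Group

variable {V : Type*} {T : SimpleGraph V}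

/-! ### Gromov products of three points -/

theorem dist_add_dist_eq_of_lt (hT : T.IsTree) (v₀ a b c : V)
    (h : T.dist a b + T.dist v₀ c < T.dist b c + T.dist v₀ a) :
    T.dist a c + T.dist v₀ b = T.dist v₀ a + T.dist b c := by
  obtain ⟨m, hma, hmb, hm, hm'⟩ := exists_dist_add_two_mul hT v₀ a b
  obtain ⟨n, hnb, hnc, hn, hn'⟩ := exists_dist_add_two_mul hT v₀ b c
  obtain ⟨l, hla, hlc, hl, hl'⟩ := exists_dist_add_two_mul hT v₀ a c
  have h1 : n ≤ l := (hl' n (by omega) hnc).1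
    (((hm' n (by omega) hnb).2 (by omega)).trans ((hn' n hnb hnc).2 le_rfl))
  have h2 : ¬ n + 1 ≤ l := fun h2 => by
    have := (hn' (n + 1) (by omega) (by omega)).1
      (((hm' (n + 1) (by omega) (by omega)).2 (by omega)).symm.trans
        ((hl' (n + 1) (by omega) (by omega)).2 h2))
    omega
  omega

/-- The hypothesis says that the cancellation in `y * x` is shorter than the common terminal part of
`u` and `y`; hence `u * x` has the same cancellation. -/
theorem absLen_mul_add_eq_of_lt (hT : T.IsTree) (v₀ : V) {u y x : T ≃g T}
    (h : absLen v₀ (u * y⁻¹) + absLen v₀ x < absLen v₀ u + absLen v₀ (y * x)) :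
    absLen v₀ (u * x) + absLen v₀ y = absLen v₀ u + absLen v₀ (y * x) := by
  have e := dist_add_dist_eq_of_lt hT v₀ (u⁻¹ v₀) (y⁻¹ v₀) (x v₀)
  rw [dist_apply_apply hT, dist_apply_apply hT, dist_apply_apply hT, inv_inv, inv_inv,
    ← absLen, ← absLen, ← absLen, absLen_inv hT, absLen_inv hT] at e
  exact e (by omega)

/-! ### Symmetric strongly N-reduced sets -/

/-- The properties of `X^±`, for a strongly N-reduced set `X` generating a purely hyperbolic group,
that control the lengths of reduced products. -/
structure IsSymmReduced (hT : T.IsTree) {v₀ : V} (o : LexWellOrders T v₀)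
    (S : Set (T ≃g T)) : Prop where
  inv_mem : ∀ x ∈ S, x⁻¹ ∈ S
  one_notMem : 1 ∉ S
  hyperbolic : PurelyHyperbolic (Subgroup.closure S)
  lt_mul : ∀ x ∈ S, ∀ y ∈ S, x ≠ y⁻¹ → StarLT hT o x (x * y)

theorem StronglyNReduced.isSymmReduced {hT : T.IsTree} {v₀ : V} {o : LexWellOrders T v₀}
    {X : Set (T ≃g T)} (hX : StronglyNReduced hT o X)
    (h : PurelyHyperbolic (Subgroup.closure X)) : IsSymmReduced hT o (plusMinus X) where
  inv_mem _ := inv_mem_plusMinus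
  one_notMem := fun h1 => by
    have h2 : (1 : T ≃g T) ∈ X := h1.elim id fun h => by simpa using h
    have h3 : (1 : T ≃g T) ∈ X ∩ X⁻¹ := ⟨h2, by simpa using h2⟩
    rw [hX.n1] at h3
    exact h3
  hyperbolic := by rwa [closure_plusMinus]
  lt_mul := hX.n4

namespace IsSymmReduced

variable {hT : T.IsTree} {v₀ : V} {o : LexWellOrders T v₀} {S : Set (T ≃g T)}

theorem isHyperbolic (hS : IsSymmReduced hT o S) {x : T ≃g T} (hx : x ∈ S) : IsHyperbolic x :=
  hS.hyperbolic x (Subgroup.subset_closure hx) fun e => hS.one_notMem (e ▸ hx)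

theorem lt_mul_left (hS : IsSymmReduced hT o S) {x y : T ≃g T} (hx : x ∈ S) (hy : y ∈ S)
    (hxy : x ≠ y⁻¹) : StarLT hT o y (x * y) := by
  have h := hS.lt_mul y⁻¹ (hS.inv_mem y hy) x⁻¹ (hS.inv_mem x hx) (by rwa [inv_inv, ne_comm])
  rwa [← mul_inv_rev, starLT_inv_left, starLT_inv_right] at h

/-- If the second half of `x` is exactly cancelled by `y`, then the halves of `y` are ordered. -/
theorem pathLT_of_absLen_eq (hS : IsSymmReduced hT o S) {x y : T ≃g T} (hx : x ∈ S) (hy : y ∈ S)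
    (hxy : x ≠ y⁻¹) (h : absLen v₀ (x * y) = absLen v₀ x) :
    o.PathLT (initialHalf hT v₀ y) (initialHalf hT v₀ y⁻¹) :=
  (prec_mul_iff o (hS.isHyperbolic hy) h (h ▸ (hS.lt_mul_left hx hy hxy).absLen_le)).1
    ((hS.lt_mul x hx y hy hxy).prec h)

theorem pathLT_inv_of_absLen_eq (hS : IsSymmReduced hT o S) {x y : T ≃g T} (hx : x ∈ S)
    (hy : y ∈ S) (hxy : x ≠ y⁻¹) (h : absLen v₀ (x * y) = absLen v₀ y) :
    o.PathLT (initialHalf hT v₀ x⁻¹) (initialHalf hT v₀ x) := by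
  have := hS.pathLT_of_absLen_eq (hS.inv_mem y hy) (hS.inv_mem x hx)
    (by rwa [inv_inv, ne_comm]) (by rw [← mul_inv_rev, absLen_inv hT, absLen_inv hT, h])
  rwa [inv_inv] at this

/-- The cancellation at both ends of a factor of a reduced product does not use up the factor. -/
theorem absLen_add_lt (hS : IsSymmReduced hT o S) {x y z : T ≃g T} (hx : x ∈ S) (hy : y ∈ S)
    (hz : z ∈ S) (hxy : x ≠ y⁻¹) (hyz : y ≠ z⁻¹) :
    absLen v₀ x + absLen v₀ z < absLen v₀ (x * y) + absLen v₀ (y * z) := by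
  -- N4 bounds each length on the right below by one on the left, so failure forces two equalities,
  -- which order the halves of `y` both ways.
  by_contra! h
  have h1 := (hS.lt_mul x hx y hy hxy).absLen_le
  have h2 := (hS.lt_mul_left hy hz hyz).absLen_le
  exact o.pathLT_irrefl _ (o.pathLT_trans (hS.pathLT_of_absLen_eq hx hy hxy (by omega))
    (hS.pathLT_inv_of_absLen_eq hy hz hyz (by omega)))

/-- The three claims are proved together: the middle one is the hypothesis of
`absLen_mul_add_eq_of_lt`, which drives the induction. -/
theorem isReducedProd_aux (hS : IsSymmReduced hT o S) {u y : T ≃g T} (h : IsReducedProd S u y) :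
    absLen v₀ y ≤ absLen v₀ u ∧
    (∀ x ∈ S, y ≠ x⁻¹ →
      absLen v₀ (u * y⁻¹) + absLen v₀ x < absLen v₀ u + absLen v₀ (y * x)) ∧
    (u = y ∨ StarLT hT o y u) := by
  induction h with
  | @single y hy =>
    refine ⟨le_rfl, fun x hx hyx => ?_, Or.inl rfl⟩
    have h1 := (hS.lt_mul_left hy hx hyx).absLen_le
    have h2 := (hS.isHyperbolic hy).absLen_pos hT (v₀ := v₀)
    have h3 : absLen v₀ (y * y⁻¹) = 0 := by
      rw [mul_inv_cancel, absLen_one]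
    omega
  | @mul u y x hu hx hyx ih =>
    obtain ⟨ih1, ih2, ih3⟩ := ih
    have hy := hu.last_mem
    have e := absLen_mul_add_eq_of_lt hT v₀ (ih2 x hx hyx)
    have hyx1 := (hS.lt_mul y hy x hx hyx).absLen_le
    have hyx2 := (hS.lt_mul_left hy hx hyx).absLen_le
    refine ⟨by omega, fun z hz hxz => ?_, Or.inr ?_⟩
    · have := hS.absLen_add_lt hy hx hz hyx hxz
      rw [mul_inv_cancel_right]
      omega
    · rcases ih3 with rfl | ih3
      · exact hS.lt_mul_left hy hx hyx
      rcases Nat.lt_or_ge (absLen v₀ x) (absLen v₀ (u * x)) with hlt | hge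
      · exact Or.inl hlt
      -- The chain `|x| ≤ |y * x| ≤ |u * x| ≤ |x|` collapses to equalities.
      have huy : absLen v₀ u = absLen v₀ y := by omega
      have hyx3 : absLen v₀ (y * x) = absLen v₀ x := by omega
      have hux : absLen v₀ (u * x) = absLen v₀ x := by omega
      have hu' := absLen_inv hT v₀ u
      have hy' := absLen_inv hT v₀ y
      have hhalf : initialHalf hT v₀ u⁻¹ = initialHalf hT v₀ y⁻¹ := by
        have e1 : initialHalf hT v₀ u⁻¹ = initialPath hT v₀ u⁻¹ (absLen v₀ y⁻¹ / 2) := by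
          rw [hy', ← huy, ← hu']; rfl
        rw [e1]
        refine (initialPath_eq_iff hT _ _ _ (by omega) (by omega)).2 ?_
        have := ih2 x hx hyx
        rw [inv_inv]
        omega
      have h1 : o.PathLT (initialHalf hT v₀ y) (initialHalf hT v₀ u) := by
        have := (ih3.prec huy).2
        rwa [halfPair, halfPair, hhalf, Multiset.pair_comm, Multiset.pair_comm (initialHalf _ _ u),
          o.pairLT_pair_iff] at this
      -- With `H(u⁻¹) = H(y⁻¹)` this orders the halves of `u` itself, so `prec_mul_iff` applies to
      -- the factor `u⁻¹`. Here the whole group must be hyperbolic, not just the letters.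
      have h2 := o.pathLT_trans (hS.pathLT_inv_of_absLen_eq hy hx hyx hyx3) h1
      have hu1 : u ≠ 1 := by
        rintro rfl
        have := (hS.isHyperbolic hy).absLen_pos hT (v₀ := v₀)
        rw [← huy, absLen_one] at this
        exact lt_irrefl _ this
      have hup : IsHyperbolic u⁻¹ :=
        hS.hyperbolic _ (Subgroup.inv_mem _ hu.mem_closure) (inv_ne_one.2 hu1)
      have hx' := absLen_inv hT v₀ x
      have hux' := absLen_inv hT v₀ (u * x)
      rw [mul_inv_rev] at hux'
      have h3 : Prec hT o x⁻¹ (x⁻¹ * u⁻¹) := by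
        rw [prec_mul_iff o hup (by omega) (by omega), inv_inv, hhalf]
        exact h2
      rw [← starLT_inv_left, ← starLT_inv_right, mul_inv_rev]
      exact Or.inr h3

/-- The length grows as from `y` to `y * x`; in a tie the halves of `x` decide, exactly as for `y`.
-/
theorem isReducedProd_lt_mul (hS : IsSymmReduced hT o S) {u y x : T ≃g T}
    (h : IsReducedProd S u y) (hx : x ∈ S) (hyx : y ≠ x⁻¹) : StarLT hT o u (u * x) := by
  obtain ⟨h1, h2, -⟩ := hS.isReducedProd_aux h
  have hy := h.last_mem
  have e := absLen_mul_add_eq_of_lt hT v₀ (h2 x hx hyx)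
  have hyx1 := (hS.lt_mul y hy x hx hyx).absLen_le
  have hyx2 := (hS.lt_mul_left hy hx hyx).absLen_le
  rcases Nat.lt_or_ge (absLen v₀ u) (absLen v₀ (u * x)) with hlt | hge
  · exact Or.inl hlt
  · refine Or.inr ((prec_mul_iff o (hS.isHyperbolic hx) (by omega) (by omega)).2 ?_)
    exact hS.pathLT_of_absLen_eq hy hx hyx (by omega)

theorem isReducedProd_last (hS : IsSymmReduced hT o S) {u y x : T ≃g T}
    (h : IsReducedProd S u y) (hx : x ∈ S) (hyx : y ≠ x⁻¹) : StarLT hT o x (u * x) := by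
  refine (hS.isReducedProd_aux (h.mul hx hyx)).2.2.resolve_left fun e => ?_
  obtain ⟨h1, -, -⟩ := hS.isReducedProd_aux h
  have h2 := (hS.isHyperbolic h.last_mem).absLen_pos hT (v₀ := v₀)
  rw [mul_eq_right.1 e, absLen_one] at h1
  omega

/-- The factors of a reduced product with at least two factors are smaller than the product. -/
theorem mem_or_mem_closure (hS : IsSymmReduced hT o S) {u y : T ≃g T}
    (h : IsReducedProd S u y) : u ∈ S ∨ u ∈ Subgroup.closure {z ∈ S | StarLT hT o z u} := by
  induction h with
  | single hy => exact Or.inl hy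
  | @mul u y x hu hx hyx ih =>
    have h1 := hS.isReducedProd_lt_mul hu hx hyx
    refine Or.inr (mul_mem ?_
      (Subgroup.subset_closure ⟨hx, hS.isReducedProd_last hu hx hyx⟩))
    rcases ih with ih | ih
    · exact Subgroup.subset_closure ⟨ih, h1⟩
    · refine Subgroup.closure_mono ?_ ih
      exact fun z hz => ⟨hz.1, hz.2.trans h1⟩

end IsSymmReduced

/-- A strongly N-reduced set, up to inversion, consists of the elements of the group it generates
that are not products of smaller elements of that group. -/
theorem StronglyNReduced.plusMinus_eq {hT : T.IsTree} {v₀ : V} {o : LexWellOrders T v₀}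
    {X : Set (T ≃g T)} (hX : StronglyNReduced hT o X) {G : Subgroup (T ≃g T)}
    (hG : PurelyHyperbolic G) (hXG : Subgroup.closure X = G) :
    plusMinus X = {g ∈ G | g ∉ Subgroup.closure {h ∈ G | StarLT hT o h g}} := by
  subst hXG
  have hS := hX.isSymmReduced hG
  have hmem : ∀ x ∈ plusMinus X, x ∈ Subgroup.closure X := fun x hx => by
    rw [← closure_plusMinus]
    exact Subgroup.subset_closure hx
  ext g
  constructor
  · intro hg
    refine ⟨hmem g hg, fun hcl => hX.isFreeBasis.notMem_closure hg ?_⟩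
    refine (Subgroup.closure_le _).2 ?_ hcl
    rintro h ⟨hh, hhg⟩
    rw [← closure_plusMinus] at hh
    have hsub : ∀ z ∈ plusMinus X, StarLT hT o z g →
        z ∈ {z ∈ plusMinus X | z ≠ g ∧ z ≠ g⁻¹} := by
      refine fun z hz hzg => ⟨hz, ?_, ?_⟩
      · rintro rfl
        exact starLT_irrefl o _ hzg
      -- Inverse elements have the same unordered pair of halves, so neither is smaller.
      · rintro rfl
        exact starLT_irrefl o _ ((starLT_inv_left o).1 hzg)
    rcases exists_isReducedProd hS.inv_mem hh with rfl | ⟨y, hy⟩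
    · exact one_mem _
    · rcases hS.mem_or_mem_closure hy with hy | hy
      · exact Subgroup.subset_closure (hsub h hy hhg)
      · exact Subgroup.closure_mono (fun z hz => hsub z hz.1 (hz.2.trans hhg)) hy
  · rintro ⟨hg, hcl⟩
    rw [← closure_plusMinus] at hg
    rcases exists_isReducedProd hS.inv_mem hg with rfl | ⟨y, hy⟩
    · exact absurd (one_mem _) hcl
    · refine (hS.mem_or_mem_closure hy).resolve_right fun h => hcl ?_
      refine Subgroup.closure_mono ?_ h
      exact fun z hz => ⟨hmem z hz.1, hz.2⟩

end TreeAut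

theorem mainTheorem4 {V : Type*} (T : SimpleGraph V) (hT : T.IsTree) (v₀ : V)
    (o : TreeAut.LexWellOrders T v₀)
    (G : Subgroup (T ≃g T)) (hG : TreeAut.PurelyHyperbolic G)
    (X Y : Set (T ≃g T)) (hXfin : X.Finite) (hYfin : Y.Finite)
    (hXG : Subgroup.closure X = G) (hYG : Subgroup.closure Y = G)
    (hX : TreeAut.StronglyNReduced hT o X) (hY : TreeAut.StronglyNReduced hT o Y) :
    TreeAut.plusMinus X = TreeAut.plusMinus Y := by
  rw [hX.plusMinus_eq hG hXG, hY.plusMinus_eq hG hYG]
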